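/- Theorem (number of regions of a $\beta$-extended Shi arrangement). Let $n\ge 1$, let $\beta=(\beta(1),\dots,\beta(n))\in\mathbb{N}^n$ (where $0\in\mathbb{N}$), and let $V_{n-1}=\{x\in\mathbb{R}^n : x_1+\cdots+x_n=0\}$. Let $\mathcal{A}$ be the $\beta$-extended Shi arrangement, that is, the collection of all hyperplanes $$x_i-x_j=-\beta(i),\,-\beta(i)+1,\,\dots,\,\beta(j)+1\qquad(1\le i<j\le n)$$ in $V_{n-1}$. Then the number $r(\mathcal{A})$ of regions of $\mathcal{A}$ (the connected components of the complement in $V_{n-1}$ of the union of these hyperplanes) is finite and equal to $$r(\mathcal{A})=\Bigl(\sum_{j=1}^n(\beta(j)+1)+1\Bigr)^{n-1}.$$ -/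

import Mathlib

/-- The space `V_{n-1}`: the vectors of `ℝ^n` whose coordinates sum to zero. -/
def sumZeroSpace (n : ℕ) : Submodule ℝ (Fin n → ℝ) where
  carrier := {x | ∑ i, x i = 0}
  add_mem' := by
    intro a b ha hb
    simp only [Set.mem_ofPred_eq, Pi.add_apply, Finset.sum_add_distrib] at *
    rw [ha, hb, add_zero]
  zero_mem' := by simp
  smul_mem' := by
    intro c x hx
    simp only [Set.mem_ofPred_eq, Pi.smul_apply, smul_eq_mul, ← Finset.mul_sum] at *
    rw [hx, mul_zero]

/-- The hyperplane `x_i - x_j = c` in `V_{n-1}` (used for `i ≠ j` only). -/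
def diffHyperplane {n : ℕ} (i j : Fin n) (c : ℝ) : Set (sumZeroSpace n) :=
  {x | (x : Fin n → ℝ) i - (x : Fin n → ℝ) j = c}

/-- The `β`-extended Shi arrangement in `V_{n-1}`: all the hyperplanes
`x_i - x_j = m` with `i < j` and `m = -β(i), -β(i) + 1, …, β(j) + 1`. -/
def extendedShiArrangement {n : ℕ} (β : Fin n → ℕ) : Set (Set (sumZeroSpace n)) :=
  {H | ∃ i j : Fin n, i < j ∧
    ∃ m : ℤ, -(β i : ℤ) ≤ m ∧ m ≤ (β j : ℤ) + 1 ∧ H = diffHyperplane i j (m : ℝ)}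

/-- The regions of an arrangement, given as a set of hyperplanes in a real topological vector
space: the connected components of the complement of the union of the hyperplanes. -/
def arrangementRegions {V : Type*} [TopologicalSpace V] (A : Set (Set V)) : Set (Set V) :=
  {R | ∃ x ∈ (⋃₀ A)ᶜ, R = connectedComponentIn (⋃₀ A)ᶜ x}

/-! For all large integers `q`, the numbers of points modulo `q` off the hyperplanes
`x i - x j = m` satisfy the same deletion-restriction recursion as the numbers of regions over `ℝ`.
Hence these point counts are the values of a polynomial `χ` in `q`, and the number of regions in
`ℝ ^ n` is `(-1) ^ n * χ (-1)` (Athanasiadis' finite field method together with Zaslavsky's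
theorem). Passing to the vectors with coordinate sum zero does not change the number of regions.

For the extended Shi arrangement, the points modulo `q` are the placements of arcs of lengths
`b i = β i + 1` on a circle of `q` cells, such that an arc immediately followed by another one has
the smaller label. Cutting the circle open at a marked empty cell gives a placement on a line, which
is determined by the number of empty cells to the left of each arc, because the arcs in the same gap
are ordered by their labels. So there are `(q - ∑ i, b i) ^ n` placements for each choice of marked
cell; as each placement has `q - ∑ i, b i` empty cells, there are
`q * (q - ∑ i, b i) ^ (n - 1)` placements, and the value of this polynomial at `-1` is
`(-1) ^ n * (∑ i, b i + 1) ^ (n - 1)`. -/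

open Filter Polynomial Topology

section Complement

variable {k V W : Type*} [Ring k] [AddCommGroup V] [Module k V] [AddCommGroup W] [Module k W]

/-- The complement of the arrangement of the zero sets of the affine forms in `L`. The forms are
kept in a list, with possible repetitions, because distinct forms may have the same restriction to
a hyperplane. -/
def avoidSet (L : List (V →ᵃ[k] k)) : Set V :=
  {x | ∀ f ∈ L, f x ≠ 0}

theorem avoidSet_nil : avoidSet ([] : List (V →ᵃ[k] k)) = Set.univ := by
  simp [avoidSet]

theorem avoidSet_cons (f : V →ᵃ[k] k) (L : List (V →ᵃ[k] k)) :
    avoidSet (f :: L) = avoidSet L \ {x | f x = 0} := by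
  ext x
  simp [avoidSet, and_comm]

theorem preimage_avoidSet (L : List (V →ᵃ[k] k)) (e : W →ᵃ[k] V) :
    e ⁻¹' avoidSet L = avoidSet (L.map (·.comp e)) := by
  ext y
  simp [avoidSet]

theorem ncard_avoidSet_cons_add [Finite V] {f : V →ᵃ[k] k} {e : W →ᵃ[k] V}
    (he : Function.Injective e) (hrange : Set.range e = {x | f x = 0}) (L : List (V →ᵃ[k] k)) :
    (avoidSet (f :: L)).ncard + (avoidSet (L.map (·.comp e))).ncard = (avoidSet L).ncard := by
  rw [← preimage_avoidSet, ← Set.ncard_image_of_injective _ he, Set.image_preimage_eq_inter_range,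
    hrange, avoidSet_cons, add_comm, Set.ncard_inter_add_ncard_sdiff_eq_ncard]

end Complement

section SignVectors

variable {V W : Type*} [AddCommGroup V] [Module ℝ V] [AddCommGroup W] [Module ℝ W]

/-- The signs at `x` of the affine forms in `L`. -/
noncomputable def signVector (L : List (V →ᵃ[ℝ] ℝ)) (x : V) : List SignType :=
  L.map fun f => SignType.sign (f x)

/-- The topes of `L` that are realized in `s`: the sign vectors of those points of `s` at which no
form in `L` vanishes. For `s = Set.univ` they correspond to the regions of the arrangement, and for
other `s` to the regions that `s` meets. -/
def topes (L : List (V →ᵃ[ℝ] ℝ)) (s : Set V) : Set (List SignType) :=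
  signVector L '' (avoidSet L ∩ s)

theorem signVector_map_comp (L : List (V →ᵃ[ℝ] ℝ)) (e : W →ᵃ[ℝ] V) (y : W) :
    signVector (L.map (·.comp e)) y = signVector L (e y) := by
  simp [signVector]

theorem signVector_eq_iff {L : List (V →ᵃ[ℝ] ℝ)} {x y : V} :
    signVector L x = signVector L y ↔ ∀ f ∈ L, SignType.sign (f x) = SignType.sign (f y) :=
  List.map_inj_left

theorem mem_avoidSet_iff_zero_notMem_signVector {L : List (V →ᵃ[ℝ] ℝ)} {x : V} :
    x ∈ avoidSet L ↔ 0 ∉ signVector L x := by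
  simp [avoidSet, signVector]

theorem mem_avoidSet_congr {L : List (V →ᵃ[ℝ] ℝ)} {x y : V}
    (h : signVector L x = signVector L y) : x ∈ avoidSet L ↔ y ∈ avoidSet L := by
  simp only [mem_avoidSet_iff_zero_notMem_signVector, h]

theorem finite_topes (L : List (V →ᵃ[ℝ] ℝ)) (s : Set V) : (topes L s).Finite := by
  refine (List.finite_length_eq SignType L.length).subset ?_
  rintro _ ⟨x, -, rfl⟩
  simp [signVector]

theorem topes_union (L : List (V →ᵃ[ℝ] ℝ)) (s t : Set V) :
    topes L (s ∪ t) = topes L s ∪ topes L t := by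
  simp only [topes, Set.inter_union_distrib_left, Set.image_union]

theorem topes_range (L : List (V →ᵃ[ℝ] ℝ)) (e : W →ᵃ[ℝ] V) :
    topes L (Set.range e) = topes (L.map (·.comp e)) Set.univ := by
  rw [topes, topes, Set.inter_univ, ← Set.image_preimage_eq_inter_range, Set.image_image,
    preimage_avoidSet]
  simp only [signVector_map_comp]

theorem topes_eq_of_forall_exists {L : List (V →ᵃ[ℝ] ℝ)} {s t : Set V} (hst : s ⊆ t)
    (h : ∀ x ∈ t, x ∈ avoidSet L → ∃ y ∈ s, signVector L y = signVector L x) :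
    topes L s = topes L t := by
  refine (Set.image_mono (Set.inter_subset_inter_right _ hst)).antisymm ?_
  rintro _ ⟨x, ⟨hx, hxt⟩, rfl⟩
  obtain ⟨y, hys, hyx⟩ := h x hxt hx
  exact ⟨y, ⟨(mem_avoidSet_congr hyx).2 hx, hys⟩, hyx⟩

theorem convex_setOf_sign_eq (s : SignType) : Convex ℝ {r : ℝ | SignType.sign r = s} := by
  cases s
  · simp only [SignType.zero_eq_zero, sign_eq_zero_iff]
    exact convex_singleton 0
  · simp only [SignType.neg_eq_neg_one, sign_eq_neg_one_iff]
    exact convex_Iio 0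
  · simp only [SignType.pos_eq_one, sign_eq_one_iff]
    exact convex_Ioi 0

theorem convex_setOf_signVector_eq (L : List (V →ᵃ[ℝ] ℝ)) (x : V) :
    Convex ℝ {y | signVector L y = signVector L x} := by
  simp only [signVector_eq_iff, Set.ofPred_forall]
  exact convex_iInter₂ fun f _ => (convex_setOf_sign_eq _).affine_preimage f

theorem exists_signVector_eq_and_eq_zero {L : List (V →ᵃ[ℝ] ℝ)} {f : V →ᵃ[ℝ] ℝ} {x y : V}
    (hxy : signVector L x = signVector L y) (hx : f x ≤ 0) (hy : 0 ≤ f y) :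
    ∃ z, signVector L z = signVector L y ∧ f z = 0 :=
  ((convex_setOf_signVector_eq L y).affine_image f).ordConnected.out
    (Set.mem_image_of_mem f hxy) (Set.mem_image_of_mem f rfl) ⟨hx, hy⟩

theorem affineMap_add_smul (f : V →ᵃ[ℝ] ℝ) (x v : V) (ε : ℝ) :
    f (x + ε • v) = f x + ε * f.linear v := by
  rw [add_comm x, ← vadd_eq_add, f.map_vadd]
  simp [add_comm]

theorem eventually_signVector_add_smul_eq {L : List (V →ᵃ[ℝ] ℝ)} {x : V} (hx : x ∈ avoidSet L)
    (v : V) : ∀ᶠ ε : ℝ in 𝓝 0, signVector L (x + ε • v) = signVector L x := by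
  simp only [signVector_eq_iff]
  refine (eventually_all_finite L.finite_toSet).2 fun f hf => ?_
  have hline : Tendsto (fun ε : ℝ => f (x + ε • v)) (𝓝 0) (𝓝 (f x)) := by
    have hcont : Continuous fun ε : ℝ => f x + ε * f.linear v := by fun_prop
    simpa [affineMap_add_smul] using hcont.tendsto 0
  exact ((continuousAt_sign_of_ne_zero (hx f hf)).tendsto.comp hline).eventually_mem
    (mem_nhds_discrete.2 (Set.mem_singleton _))

theorem exists_signVector_eq_and_pos {L : List (V →ᵃ[ℝ] ℝ)} {f : V →ᵃ[ℝ] ℝ}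
    (hf : f.linear ≠ 0) {x : V} (hx : x ∈ avoidSet L) (hfx : 0 ≤ f x) :
    ∃ y, signVector L y = signVector L x ∧ 0 < f y := by
  obtain ⟨v, hv⟩ : ∃ v, 0 < f.linear v := by
    obtain ⟨v, hv⟩ := DFunLike.ne_iff.1 hf
    rcases lt_or_gt_of_ne hv with hneg | hpos
    · exact ⟨-v, by simpa using hneg⟩
    · exact ⟨v, hpos⟩
  obtain ⟨ε, hsign, hε⟩ := (((eventually_signVector_add_smul_eq hx v).filter_mono
    nhdsWithin_le_nhds).and (self_mem_nhdsWithin (s := Set.Ioi 0))).exists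
  refine ⟨x + ε • v, hsign, ?_⟩
  rw [affineMap_add_smul]
  exact add_pos_of_nonneg_of_pos hfx (mul_pos hε hv)

theorem exists_signVector_eq_and_neg {L : List (V →ᵃ[ℝ] ℝ)} {f : V →ᵃ[ℝ] ℝ}
    (hf : f.linear ≠ 0) {x : V} (hx : x ∈ avoidSet L) (hfx : f x ≤ 0) :
    ∃ y, signVector L y = signVector L x ∧ f y < 0 := by
  simpa using exists_signVector_eq_and_pos (f := -f) (by simpa using hf) hx (by simpa using hfx)

theorem topes_pos_union_topes_neg {f : V →ᵃ[ℝ] ℝ} (hf : f.linear ≠ 0) (L : List (V →ᵃ[ℝ] ℝ)) :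
    topes L {x | 0 < f x} ∪ topes L {x | f x < 0} = topes L Set.univ := by
  rw [← topes_union]
  refine topes_eq_of_forall_exists (Set.subset_univ _) fun x _ hx => ?_
  rcases le_or_gt 0 (f x) with hfx | hfx
  · obtain ⟨y, hyx, hy⟩ := exists_signVector_eq_and_pos hf hx hfx
    exact ⟨y, Or.inl hy, hyx⟩
  · exact ⟨x, Or.inr hfx, rfl⟩

theorem topes_pos_inter_topes_neg {f : V →ᵃ[ℝ] ℝ} (hf : f.linear ≠ 0) (L : List (V →ᵃ[ℝ] ℝ)) :
    topes L {x | 0 < f x} ∩ topes L {x | f x < 0} = topes L {x | f x = 0} := by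
  apply Set.Subset.antisymm
  · rintro _ ⟨⟨x, ⟨hx, hfx⟩, rfl⟩, ⟨y, ⟨-, hfy⟩, hyx⟩⟩
    obtain ⟨z, hzx, hfz⟩ := exists_signVector_eq_and_eq_zero hyx (le_of_lt hfy) (le_of_lt hfx)
    exact ⟨z, ⟨(mem_avoidSet_congr hzx).2 hx, hfz⟩, hzx⟩
  · rintro _ ⟨x, ⟨hx, hfx⟩, rfl⟩
    obtain ⟨y, hyx, hfy⟩ := exists_signVector_eq_and_pos hf hx (le_of_eq hfx.symm)
    obtain ⟨z, hzx, hfz⟩ := exists_signVector_eq_and_neg hf hx (le_of_eq hfx)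
    exact ⟨⟨y, ⟨(mem_avoidSet_congr hyx).2 hx, hfy⟩, hyx⟩,
      ⟨z, ⟨(mem_avoidSet_congr hzx).2 hx, hfz⟩, hzx⟩⟩

theorem topes_cons (f : V →ᵃ[ℝ] ℝ) (L : List (V →ᵃ[ℝ] ℝ)) (s : Set V) :
    topes (f :: L) s = List.cons 1 '' topes L (s ∩ {x | 0 < f x}) ∪
      List.cons (-1) '' topes L (s ∩ {x | f x < 0}) := by
  simp only [topes, Set.image_image]
  have hsplit : avoidSet (f :: L) ∩ s =
      avoidSet L ∩ (s ∩ {x | 0 < f x}) ∪ avoidSet L ∩ (s ∩ {x | f x < 0}) := by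
    ext x
    simp only [avoidSet_cons, Set.mem_inter_iff, Set.mem_sdiff, Set.mem_union, Set.mem_ofPred_eq]
    grind
  rw [hsplit, Set.image_union]
  congr 1 <;> refine Set.image_congr fun x hx => ?_
  · simpa [signVector] using sign_pos hx.2.2
  · simpa [signVector] using sign_neg hx.2.2

theorem ncard_topes_cons (f : V →ᵃ[ℝ] ℝ) (L : List (V →ᵃ[ℝ] ℝ)) (s : Set V) :
    (topes (f :: L) s).ncard =
      (topes L (s ∩ {x | 0 < f x})).ncard + (topes L (s ∩ {x | f x < 0})).ncard := by
  have hdisj : Disjoint (List.cons (1 : SignType) '' topes L (s ∩ {x | 0 < f x}))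
      (List.cons (-1) '' topes L (s ∩ {x | f x < 0})) := by
    rw [Set.disjoint_left]
    rintro _ ⟨p, -, rfl⟩ ⟨p', -, h⟩
    simp at h
  rw [topes_cons, Set.ncard_union_eq hdisj ((finite_topes _ _).image _)
      ((finite_topes _ _).image _),
    Set.ncard_image_of_injective _ List.cons_injective,
    Set.ncard_image_of_injective _ List.cons_injective]

/-- Zaslavsky's recursion: the topes cut in two by `f = 0` are those of the restriction to it. -/
theorem ncard_topes_cons_of_range_eq {f : V →ᵃ[ℝ] ℝ} (hf : f.linear ≠ 0) {e : W →ᵃ[ℝ] V}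
    (hrange : Set.range e = {x | f x = 0}) (L : List (V →ᵃ[ℝ] ℝ)) :
    (topes (f :: L) Set.univ).ncard =
      (topes L Set.univ).ncard + (topes (L.map (·.comp e)) Set.univ).ncard := by
  rw [ncard_topes_cons, Set.univ_inter, Set.univ_inter, ← topes_pos_union_topes_neg hf L,
    ← topes_range, hrange, ← topes_pos_inter_topes_neg hf L,
    Set.ncard_union_add_ncard_inter _ _ (finite_topes _ _) (finite_topes _ _)]

theorem ncard_topes_const_cons {c : ℝ} (hc : c ≠ 0) (L : List (V →ᵃ[ℝ] ℝ)) (s : Set V) :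
    (topes (AffineMap.const ℝ V c :: L) s).ncard = (topes L s).ncard := by
  rw [ncard_topes_cons]
  rcases lt_or_gt_of_ne hc with h | h <;> simp [topes, h, h.not_gt]

end SignVectors

section Regions

variable {V : Type*} [AddCommGroup V] [Module ℝ V] [TopologicalSpace V]

theorem signVector_eq_of_mem_connectedComponentIn {L : List (V →ᵃ[ℝ] ℝ)}
    (hL : ∀ f ∈ L, Continuous f) {x y : V} (hx : x ∈ avoidSet L)
    (hy : y ∈ connectedComponentIn (avoidSet L) x) : signVector L x = signVector L y := by
  refine signVector_eq_iff.2 fun f hf => ?_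
  have hcont : ContinuousOn (fun z => SignType.sign (f z)) (connectedComponentIn (avoidSet L) x) :=
    fun z hz => ContinuousAt.continuousWithinAt <|
      (continuousAt_sign_of_ne_zero (connectedComponentIn_subset _ _ hz f hf)).comp
        (hL f hf).continuousAt
  exact isPreconnected_connectedComponentIn.constant hcont (mem_connectedComponentIn hx) hy

theorem connectedComponentIn_avoidSet_eq_iff [ContinuousAdd V] [ContinuousSMul ℝ V]
    {L : List (V →ᵃ[ℝ] ℝ)} (hL : ∀ f ∈ L, Continuous f) {x y : V} (hx : x ∈ avoidSet L)
    (hy : y ∈ avoidSet L) :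
    connectedComponentIn (avoidSet L) x = connectedComponentIn (avoidSet L) y ↔
      signVector L x = signVector L y := by
  constructor
  · intro h
    exact signVector_eq_of_mem_connectedComponentIn hL hx (h ▸ mem_connectedComponentIn hy)
  · intro h
    refine connectedComponentIn_eq ?_
    exact (convex_setOf_signVector_eq L x).isPreconnected.subset_connectedComponentIn rfl
      (fun z hz => (mem_avoidSet_congr hz).2 hx) h.symm

theorem encard_image_eq_encard_image {α β γ : Type*} {f : α → β} {g : α → γ} {s : Set α}
    (h : ∀ x ∈ s, ∀ y ∈ s, f x = f y ↔ g x = g y) : (f '' s).encard = (g '' s).encard := by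
  obtain ⟨t, hts, hgt⟩ := Set.exists_subset_bijOn s g
  have hft : f '' t = f '' s := by
    refine (Set.image_mono hts).antisymm ?_
    rintro _ ⟨x, hx, rfl⟩
    obtain ⟨y, hy, hyx⟩ := hgt.surjOn (Set.mem_image_of_mem g hx)
    exact ⟨y, hy, (h y (hts hy) x hx).2 hyx⟩
  have hinj : Set.InjOn f t := fun x hx y hy hxy =>
    hgt.injOn hx hy ((h x (hts hx) y (hts hy)).1 hxy)
  rw [← hft, ← hgt.image_eq, hinj.encard_image, hgt.injOn.encard_image]

theorem encard_arrangementRegions [ContinuousAdd V] [ContinuousSMul ℝ V] {A : Set (Set V)}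
    {L : List (V →ᵃ[ℝ] ℝ)} (hL : ∀ f ∈ L, Continuous f) (hA : (⋃₀ A)ᶜ = avoidSet L) :
    (arrangementRegions A).encard = (topes L Set.univ).encard := by
  have himage : arrangementRegions A = connectedComponentIn (avoidSet L) '' avoidSet L := by
    simp only [arrangementRegions, hA, Set.image, eq_comm]
  rw [himage, topes, Set.inter_univ]
  exact encard_image_eq_encard_image fun x hx y hy =>
    connectedComponentIn_avoidSet_eq_iff hL hx hy

end Regions

/-- The equation `x fst - x snd = shift`: an edge of an integral gain graph, whose solution set
over a ring is an affinographic hyperplane when `fst ≠ snd`. -/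
structure DiffEquation (ι : Type*) where
  fst : ι
  snd : ι
  shift : ℤ

namespace DiffEquation

section Forms

variable {ι κ : Type*} (R : Type*) [Ring R]

/-- The affine form `x fst - x snd - shift` on `ι → R` whose zero set is the solution set. -/
def form (t : DiffEquation ι) : (ι → R) →ᵃ[R] R :=
  let coord (i : ι) : (ι → R) →ᵃ[R] R := AffineMap.proj i
  coord t.fst - coord t.snd - AffineMap.const R (ι → R) (t.shift : R)

@[simp]
theorem form_apply (t : DiffEquation ι) (x : ι → R) :
    t.form R x = x t.fst - x t.snd - t.shift := by
  simp [form]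

theorem form_linear_ne_zero [Nontrivial R] {t : DiffEquation ι} (ht : t.snd ≠ t.fst) :
    (t.form R).linear ≠ 0 := by
  classical
  intro h
  simpa [form, ht] using LinearMap.congr_fun h (Pi.single t.fst 1)

/-- The affine map substituting the variable `y (σ a)` plus the constant `c a` for `x a`. -/
def substitution (σ : ι → κ) (c : ι → ℤ) : (κ → R) →ᵃ[R] (ι → R) :=
  (LinearMap.funLeft R R σ).toAffineMap + AffineMap.const R (κ → R) fun a => (c a : R)

@[simp]
theorem substitution_apply (σ : ι → κ) (c : ι → ℤ) (y : κ → R) (a : ι) :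
    substitution R σ c y a = y (σ a) + c a := by
  simp [substitution, LinearMap.funLeft_apply]

theorem substitution_injective {σ : ι → κ} (hσ : Function.Surjective σ) (c : ι → ℤ) :
    Function.Injective (substitution R σ c) := fun y z h =>
  hσ.injective_comp_right <| funext fun a => by simpa using congrFun h a

/-- The equation obtained by substituting `y (σ a) + c a` for `x a`. -/
def pullback (σ : ι → κ) (c : ι → ℤ) (t : DiffEquation ι) : DiffEquation κ :=
  ⟨σ t.fst, σ t.snd, t.shift - c t.fst + c t.snd⟩

theorem form_pullback (σ : ι → κ) (c : ι → ℤ) (t : DiffEquation ι) :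
    (t.pullback σ c).form R = (t.form R).comp (substitution R σ c) := by
  ext y
  simp only [pullback, form_apply, AffineMap.comp_apply, substitution_apply]
  push_cast
  abel

theorem map_form_map_pullback (L : List (DiffEquation ι)) (σ : ι → κ) (c : ι → ℤ) :
    (L.map (pullback σ c)).map (form R) = (L.map (form R)).map (·.comp (substitution R σ c)) := by
  simp only [List.map_map, Function.comp_def, form_pullback]

end Forms

section Elimination

variable {ι : Type*} [DecidableEq ι] {t : DiffEquation ι} (ht : t.snd ≠ t.fst)

/-- Solving `t` for the variable `fst` replaces this variable by `snd`, up to a constant. -/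
def eliminate (a : ι) : {a : ι // a ≠ t.fst} :=
  if h : a = t.fst then ⟨t.snd, ht⟩ else ⟨a, h⟩

/-- The equation `s` on the solutions of `t`, in the variables other than `t.fst`. -/
def restrict (s : DiffEquation ι) : DiffEquation {a : ι // a ≠ t.fst} :=
  s.pullback (eliminate ht) (Pi.single t.fst t.shift)

theorem eliminate_surjective : Function.Surjective (eliminate ht) := fun a =>
  ⟨a, by simp [eliminate, a.2]⟩

theorem range_substitution_eliminate (R : Type*) [Ring R] :
    Set.range (substitution R (eliminate ht) (Pi.single t.fst t.shift)) = {x | t.form R x = 0} := by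
  ext x
  constructor
  · rintro ⟨y, rfl⟩
    simp [eliminate, ht]
  · intro hx
    refine ⟨fun a => x a, funext fun a => ?_⟩
    rcases eq_or_ne a t.fst with rfl | ha
    · rw [Set.mem_ofPred_eq, form_apply, sub_sub, sub_eq_zero] at hx
      simp [eliminate, hx]
    · simp [eliminate, ha]

theorem ncard_avoidSet_cons_add_restrict [Finite ι] (R : Type*) [Ring R] [Finite R]
    (L : List (DiffEquation ι)) :
    (avoidSet ((t :: L).map (form R))).ncard +
      (avoidSet ((L.map (restrict ht)).map (form R))).ncard =
        (avoidSet (L.map (form R))).ncard := by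
  rw [funext (restrict.eq_1 ht), map_form_map_pullback]
  exact ncard_avoidSet_cons_add (substitution_injective R (eliminate_surjective ht) _)
    (range_substitution_eliminate ht R) _

theorem ncard_topes_cons_eq_add_restrict (L : List (DiffEquation ι)) :
    (topes ((t :: L).map (form ℝ)) Set.univ).ncard = (topes (L.map (form ℝ)) Set.univ).ncard +
      (topes ((L.map (restrict ht)).map (form ℝ)) Set.univ).ncard := by
  rw [funext (restrict.eq_1 ht), map_form_map_pullback]
  exact ncard_topes_cons_of_range_eq (form_linear_ne_zero ℝ ht)
    (range_substitution_eliminate ht ℝ) _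

end Elimination

/-- Athanasiadis' finite field method: the characteristic polynomial of the arrangement of the
equations in `L` is the polynomial that counts the points of its complement modulo `q`, for all
large `q`. -/
def IsCharPoly {ι : Type*} (L : List (DiffEquation ι)) (P : ℤ[X]) : Prop :=
  ∀ᶠ q : ℕ in atTop, ((avoidSet (L.map (form (ZMod q)))).ncard : ℤ) = P.eval (q : ℤ)

namespace IsCharPoly

theorem unique {ι : Type*} {L : List (DiffEquation ι)} {P Q : ℤ[X]} (hP : IsCharPoly L P)
    (hQ : IsCharPoly L Q) : P = Q := by
  obtain ⟨N, hN⟩ := eventually_atTop.1 (hP.and hQ)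
  refine eq_of_infinite_eval_eq _ _ (((Set.Ici_infinite N).image
    (Nat.cast_injective (R := ℤ)).injOn).mono ?_)
  rintro _ ⟨q, hq, rfl⟩
  exact (hN q hq).1.symm.trans (hN q hq).2

variable {ι : Type*}

theorem nil [Fintype ι] : IsCharPoly ([] : List (DiffEquation ι)) (X ^ Fintype.card ι) := by
  filter_upwards [eventually_gt_atTop 0] with q hq
  have : NeZero q := ⟨hq.ne'⟩
  simp [avoidSet_nil, Set.ncard_univ, Nat.card_fun]

theorem zero_cons (i : ι) (L : List (DiffEquation ι)) : IsCharPoly (⟨i, i, 0⟩ :: L) 0 :=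
  Eventually.of_forall fun q => by simp [avoidSet]

theorem loop_cons {L : List (DiffEquation ι)} {P : ℤ[X]} (hP : IsCharPoly L P) (i : ι) {m : ℤ}
    (hm : m ≠ 0) : IsCharPoly (⟨i, i, m⟩ :: L) P := by
  filter_upwards [hP, eventually_gt_atTop m.natAbs] with q hq hqm
  have hmq : (m : ZMod q) ≠ 0 := fun h =>
    hm (Int.eq_zero_of_abs_lt_dvd ((ZMod.intCast_zmod_eq_zero_iff_dvd m q).1 h)
      (by rw [Int.abs_eq_natAbs]; lia))
  rw [← hq, List.map_cons, avoidSet_cons]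
  simp [hmq]

theorem cons [Finite ι] [DecidableEq ι] {t : DiffEquation ι} (ht : t.snd ≠ t.fst)
    {L : List (DiffEquation ι)} {P Q : ℤ[X]} (hP : IsCharPoly L P)
    (hQ : IsCharPoly (L.map (restrict ht)) Q) : IsCharPoly (t :: L) (P - Q) := by
  filter_upwards [hP, hQ, eventually_gt_atTop 0] with q hPq hQq hq
  have : NeZero q := ⟨hq.ne'⟩
  rw [eval_sub, ← hPq, ← hQq, ← ncard_avoidSet_cons_add_restrict ht (ZMod q) L, Nat.cast_add,
    add_sub_cancel_right]

end IsCharPoly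

/-- Zaslavsky's theorem: both sides satisfy the same deletion-restriction recursion. -/
theorem exists_isCharPoly {ι : Type*} [Fintype ι] (L : List (DiffEquation ι)) :
    ∃ P, IsCharPoly L P ∧ ((topes (L.map (form ℝ)) Set.univ).ncard : ℤ) =
      (-1) ^ Fintype.card ι * P.eval (-1) := by
  classical
  match L with
  | [] =>
    refine ⟨_, IsCharPoly.nil, ?_⟩
    simp [topes, avoidSet, signVector, ← mul_pow]
  | t :: L =>
    obtain ⟨P, hP, hregions⟩ := exists_isCharPoly L
    by_cases ht : t.snd = t.fst
    · obtain ⟨i, j, m⟩ := t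
      obtain rfl : j = i := ht
      rcases eq_or_ne m 0 with rfl | hm
      · refine ⟨0, IsCharPoly.zero_cons j L, ?_⟩
        simp [topes, avoidSet]
      · refine ⟨P, hP.loop_cons j hm, ?_⟩
        have hform : form ℝ ⟨j, j, m⟩ = AffineMap.const ℝ (ι → ℝ) (-m : ℝ) := by
          ext x
          simp
        rw [List.map_cons, hform, ncard_topes_const_cons (by simpa using hm), hregions]
    · obtain ⟨Q, hQ, hrestrict⟩ := exists_isCharPoly (L.map (restrict ht))
      refine ⟨P - Q, hP.cons ht hQ, ?_⟩
      have hcard : Fintype.card ι = Fintype.card {a : ι // a ≠ t.fst} + 1 := by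
        rw [Fintype.card_subtype_compl, Fintype.card_subtype_eq,
          Nat.sub_add_cancel (Fintype.card_pos_iff.2 ⟨t.fst⟩)]
      rw [ncard_topes_cons_eq_add_restrict ht, Nat.cast_add, hregions, hrestrict, eval_sub, hcard]
      ring
termination_by L.length

theorem IsCharPoly.ncard_topes {ι : Type*} [Fintype ι] {L : List (DiffEquation ι)} {P : ℤ[X]}
    (hP : IsCharPoly L P) : ((topes (L.map (form ℝ)) Set.univ).ncard : ℤ) =
      (-1) ^ Fintype.card ι * P.eval (-1) := by
  obtain ⟨Q, hQ, hregions⟩ := exists_isCharPoly L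
  rw [hP.unique hQ, hregions]

end DiffEquation

section LinePlacements

theorem lt_iff_lt_of_forall_lt_imp_lt {ι α β : Type*} [LinearOrder α] [Preorder β] {f : ι → α}
    {g : ι → β} (hf : Function.Injective f) (hfg : ∀ i j, f i < f j → g i < g j) {i j : ι} :
    g i < g j ↔ f i < f j := by
  refine ⟨fun h => ?_, hfg i j⟩
  have hne : f i ≠ f j := fun he => h.ne (congrArg g (hf he))
  exact hne.lt_or_gt.resolve_right fun h' => h.not_gt (hfg j i h')

theorem sum_filter_lt_add_le_sum_filter_lt {ι α : Type*} [Fintype ι] [Preorder α]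
    [DecidableLT α] (b : ι → ℕ) {f : ι → α} {i j : ι} (h : f i < f j) :
    ∑ k with f k < f i, b k + b i ≤ ∑ k with f k < f j, b k := by
  classical
  rw [add_comm, ← Finset.sum_insert (by simp)]
  refine Finset.sum_le_sum_of_subset fun k hk => ?_
  simp only [Finset.mem_insert, Finset.mem_filter_univ] at hk ⊢
  rcases hk with rfl | hk
  exacts [h, hk.trans h]

/-- A placement of arcs of lengths `b i` on the cells `0, …, q - 2` of a line, where arc `i` covers
the cells `p i, …, p i + b i - 1`: the arcs are disjoint, and an arc immediately followed by another
one has the smaller label. The cell `q - 1` stays empty, so that the line can be closed up to a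
circle of `q` cells. -/
def IsLinePlacement {ι : Type*} [LT ι] (b : ι → ℕ) (q : ℕ) (p : ι → ℕ) : Prop :=
  (∀ i, p i + b i < q) ∧ ∀ i j, i < j → p i + b i ≤ p j ∨ p j + b j < p i

/-- The key by which arcs are ordered along the line when arc `i` comes after `a i` empty cells:
arcs in the same gap are adjacent, hence ordered by their labels. -/
def gapKey {ι : Type*} (a : ι → ℕ) (i : ι) : ℕ ×ₗ ι :=
  toLex (a i, i)

theorem gapKey_injective {ι : Type*} (a : ι → ℕ) : Function.Injective (gapKey a) := fun _ _ h =>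
  congrArg (fun x => (ofLex x).2) h

variable {ι : Type*} [LinearOrder ι] {b : ι → ℕ} {q : ℕ}

/-- The number of empty cells to the left of arc `i` in the placement `p`. -/
def gap [Fintype ι] (b p : ι → ℕ) (i : ι) : ℕ :=
  p i - ∑ k with p k < p i, b k

/-- The placement in which arc `i` comes after `a i` empty cells. -/
def placementOfGap [Fintype ι] (b a : ι → ℕ) (i : ι) : ℕ :=
  a i + ∑ k with gapKey a k < gapKey a i, b k

theorem gapKey_lt_iff {a : ι → ℕ} {i j : ι} :
    gapKey a i < gapKey a j ↔ a i < a j ∨ a i = a j ∧ i < j :=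
  Prod.Lex.toLex_lt_toLex

namespace IsLinePlacement

variable {p : ι → ℕ}

theorem add_le_of_lt (hp : IsLinePlacement b q p) {i j : ι} (h : p i < p j) : p i + b i ≤ p j := by
  rcases lt_trichotomy i j with hij | rfl | hij
  · have := hp.2 i j hij
    lia
  · exact absurd h (lt_irrefl _)
  · have := hp.2 j i hij
    lia

theorem add_lt_of_lt_of_gt (hp : IsLinePlacement b q p) {i j : ι} (h : p i < p j) (hij : j < i) :
    p i + b i < p j := by
  have := hp.2 j i hij
  lia

theorem injective (hp : IsLinePlacement b q p) (hb : ∀ i, 0 < b i) : Function.Injective p := by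
  intro i j h
  by_contra hne
  have hi := hb i
  have hj := hb j
  rcases lt_or_gt_of_ne hne with hij | hij
  · have := hp.2 i j hij
    lia
  · have := hp.2 j i hij
    lia

theorem sum_le_sub (hp : IsLinePlacement b q p) (hb : ∀ i, 0 < b i) {s : Finset ι} {lo hi : ℕ}
    (hs : ∀ k ∈ s, lo ≤ p k ∧ p k + b k ≤ hi) : ∑ k ∈ s, b k ≤ hi - lo := by
  have hdisj : (s : Set ι).PairwiseDisjoint fun k => Finset.Ico (p k) (p k + b k) := by
    intro k _ l _ hkl
    refine Finset.disjoint_left.2 fun x hxk hxl => ?_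
    rw [Finset.mem_Ico] at hxk hxl
    rcases lt_or_gt_of_ne ((hp.injective hb).ne hkl) with h | h
    · have := hp.add_le_of_lt h
      lia
    · have := hp.add_le_of_lt h
      lia
  calc ∑ k ∈ s, b k = (s.biUnion fun k => Finset.Ico (p k) (p k + b k)).card := by
        simp [Finset.card_biUnion hdisj]
    _ ≤ (Finset.Ico lo hi).card := by
        refine Finset.card_le_card (Finset.biUnion_subset.2 fun k hk => ?_)
        exact Finset.Ico_subset_Ico (hs k hk).1 (hs k hk).2
    _ = hi - lo := Nat.card_Ico lo hi

variable [Fintype ι]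

theorem sum_filter_lt_le (hp : IsLinePlacement b q p) (hb : ∀ i, 0 < b i) (i : ι) :
    ∑ k with p k < p i, b k ≤ p i :=
  hp.sum_le_sub hb (lo := 0) fun _ hk => ⟨Nat.zero_le _, hp.add_le_of_lt (by simpa using hk)⟩

theorem gap_lt (hp : IsLinePlacement b q p) (hb : ∀ i, 0 < b i) (i : ι) :
    gap b p i < q - ∑ i, b i := by
  have hleft := hp.sum_filter_lt_le hb i
  have hright : ∑ k with ¬ p k < p i, b k ≤ q - 1 - p i :=
    hp.sum_le_sub hb fun k hk => ⟨by simpa using hk, Nat.le_sub_one_of_lt (hp.1 k)⟩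
  have hsum := Finset.sum_filter_add_sum_filter_not Finset.univ (fun k => p k < p i) b
  have hi := hp.1 i
  unfold gap
  lia

theorem gapKey_gap_lt_of_forall_le (hp : IsLinePlacement b q p) (hb : ∀ i, 0 < b i) {i j : ι}
    (hij : p i < p j) (hadj : ∀ k, p k < p j → p k ≤ p i) :
    gapKey (gap b p) i < gapKey (gap b p) j := by
  have hset : ({k | p k < p j} : Finset ι) = insert i ({k | p k < p i} : Finset ι) := by
    ext k
    simp only [Finset.mem_insert, Finset.mem_filter_univ, ← (hp.injective hb).eq_iff (a := k)]
    have := hadj k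
    lia
  have hsum : ∑ k with p k < p j, b k = b i + ∑ k with p k < p i, b k := by
    rw [hset, Finset.sum_insert (by simp)]
  have hle := hp.sum_filter_lt_le hb i
  have hadd := hp.add_le_of_lt hij
  rw [gapKey_lt_iff]
  unfold gap
  rcases lt_trichotomy i j with h | rfl | h
  · lia
  · exact absurd hij (lt_irrefl _)
  · have := hp.add_lt_of_lt_of_gt hij h
    lia

theorem gapKey_gap_lt (hp : IsLinePlacement b q p) (hb : ∀ i, 0 < b i) (i j : ι)
    (hij : p i < p j) : gapKey (gap b p) i < gapKey (gap b p) j := by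
  induction hd : p j - p i using Nat.strong_induction_on generalizing i j with
  | _ d ih =>
    by_cases hbetween : ∃ k, p i < p k ∧ p k < p j
    · obtain ⟨k, hik, hkj⟩ := hbetween
      exact (ih (p k - p i) (by lia) i k hik rfl).trans (ih (p j - p k) (by lia) k j hkj rfl)
    · push Not at hbetween
      refine hp.gapKey_gap_lt_of_forall_le hb hij fun k hk => ?_
      exact not_lt.1 fun hik => (hbetween k hik).not_gt hk

theorem placementOfGap_gap (hp : IsLinePlacement b q p) (hb : ∀ i, 0 < b i) :
    placementOfGap b (gap b p) = p := by
  funext i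
  simp only [placementOfGap,
    lt_iff_lt_of_forall_lt_imp_lt (hp.injective hb) (hp.gapKey_gap_lt hb)]
  exact Nat.sub_add_cancel (hp.sum_filter_lt_le hb i)

end IsLinePlacement

variable [Fintype ι]

theorem gap_placementOfGap (hb : ∀ i, 0 < b i) (a : ι → ℕ) : gap b (placementOfGap b a) = a := by
  have hmono : ∀ i j, gapKey a i < gapKey a j → placementOfGap b a i < placementOfGap b a j := by
    intro i j h
    have hsum := sum_filter_lt_add_le_sum_filter_lt b h
    have hi := hb i
    rw [gapKey_lt_iff] at h
    unfold placementOfGap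
    lia
  funext i
  simp only [gap, lt_iff_lt_of_forall_lt_imp_lt (gapKey_injective a) hmono]
  exact Nat.add_sub_cancel _ _

theorem isLinePlacement_placementOfGap {a : ι → ℕ} (ha : ∀ i, a i < q - ∑ i, b i) :
    IsLinePlacement b q (placementOfGap b a) := by
  constructor
  · intro i
    have hsum : ∑ k with gapKey a k < gapKey a i, b k + b i ≤ ∑ k, b k := by
      rw [add_comm, ← Finset.sum_insert (by simp)]
      exact Finset.sum_le_sum_of_subset (Finset.subset_univ _)
    have := ha i
    unfold placementOfGap
    lia
  · intro i j hij
    unfold placementOfGap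
    rcases lt_or_gt_of_ne ((gapKey_injective a).ne hij.ne) with h | h
    · have hsum := sum_filter_lt_add_le_sum_filter_lt b h
      rw [gapKey_lt_iff] at h
      lia
    · have hsum := sum_filter_lt_add_le_sum_filter_lt b h
      have hlt : a j < a i := (gapKey_lt_iff.1 h).resolve_right fun hji => hij.not_gt hji.2
      lia

theorem ncard_isLinePlacement (hb : ∀ i, 0 < b i) :
    {p | IsLinePlacement b q p}.ncard = (q - ∑ i, b i) ^ Fintype.card ι := by
  have hbij : Set.BijOn (placementOfGap b)
      (Fintype.piFinset fun _ : ι => Finset.range (q - ∑ i, b i) : Finset (ι → ℕ))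
      {p | IsLinePlacement b q p} := by
    refine Set.InvOn.bijOn (f' := gap b)
      ⟨fun a _ => gap_placementOfGap hb a, fun p hp => hp.placementOfGap_gap hb⟩ ?_ ?_
    · intro a ha
      exact isLinePlacement_placementOfGap (by simpa using ha)
    · intro p hp
      simpa using hp.gap_lt hb
  rw [← hbij.ncard_eq, Set.ncard_coe_finset]
  simp

end LinePlacements

section CirclePlacements

/-- The cell `e` of the circle `ZMod q` is not covered by any of the arcs
`x i, …, x i + b i - 1`. -/
def IsEmptyCell {ι : Type*} (b : ι → ℕ) {q : ℕ} (x : ι → ZMod q) (e : ZMod q) : Prop :=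
  ∀ i, ∀ t < b i, x i + t ≠ e

/-- A placement of arcs of lengths `b i` on the circle `ZMod q`, where arc `i` covers the cells
`x i, …, x i + b i - 1`: the arcs are disjoint, and an arc immediately followed by another one has
the smaller label. For `i < j` the excluded differences `m ≤ 0` are those for which arc `j` starts
on arc `i`, and the differences `m ≥ 0` those for which arc `i` starts on arc `j` or just after
it. -/
def IsCirclePlacement {ι : Type*} [LT ι] (b : ι → ℕ) {q : ℕ} (x : ι → ZMod q) : Prop :=
  ∀ i j, i < j → ∀ m : ℤ, -b i < m → m ≤ b j → x i - x j ≠ m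

theorem isEmptyCell_add_const_iff {ι : Type*} {b : ι → ℕ} {q : ℕ} {x : ι → ZMod q}
    {c e : ZMod q} : IsEmptyCell b (fun i => x i + c) (e + c) ↔ IsEmptyCell b x e := by
  simp only [IsEmptyCell, add_right_comm _ c, ne_eq, add_left_inj]

theorem isCirclePlacement_add_const_iff {ι : Type*} [LT ι] {b : ι → ℕ} {q : ℕ}
    {x : ι → ZMod q} {c : ZMod q} :
    IsCirclePlacement b (fun i => x i + c) ↔ IsCirclePlacement b x := by
  simp only [IsCirclePlacement, add_sub_add_right_eq_sub]

variable {ι : Type*} [LinearOrder ι] {b : ι → ℕ} {q : ℕ}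

theorem IsLinePlacement.isCirclePlacement_natCast {p : ι → ℕ} (hp : IsLinePlacement b q p) :
    IsCirclePlacement b fun i => (p i : ZMod q) := by
  intro i j hij m hmi hmj h
  have hdvd : (q : ℤ) ∣ m - (p i - p j) := by
    rw [← ZMod.intCast_eq_intCast_iff_dvd_sub]
    push_cast
    exact h
  have hi := hp.1 i
  have hj := hp.1 j
  have hm := Int.eq_zero_of_abs_lt_dvd hdvd (by rw [abs_lt]; lia)
  have := hp.2 i j hij
  lia

theorem IsLinePlacement.isEmptyCell_natCast {p : ι → ℕ} (hp : IsLinePlacement b q p) :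
    IsEmptyCell b (fun i => (p i : ZMod q)) (-1) := by
  intro i t ht h
  have hdvd : q ∣ p i + t + 1 := by
    rw [← ZMod.natCast_eq_zero_iff]
    push_cast
    rw [h, neg_add_cancel]
  have hle := Nat.le_of_dvd (Nat.succ_pos _) hdvd
  have hi := hp.1 i
  lia

theorem IsCirclePlacement.isLinePlacement_val [NeZero q] {x : ι → ZMod q}
    (hx : IsCirclePlacement b x) (hempty : IsEmptyCell b x (-1)) :
    IsLinePlacement b q fun i => (x i).val := by
  constructor
  · intro i
    by_contra! h
    have hlt := ZMod.val_lt (x i)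
    refine hempty i (q - 1 - (x i).val) (by lia) ?_
    rw [Nat.cast_sub (by lia), Nat.cast_sub (by lia), ZMod.natCast_zmod_val]
    simp
  · intro i j hij
    by_contra! h
    refine hx i j hij ((x i).val - (x j).val) (by lia) (by lia) ?_
    push_cast
    rw [ZMod.natCast_zmod_val, ZMod.natCast_zmod_val]

theorem IsCirclePlacement.injective_sigma {x : ι → ZMod q} (hx : IsCirclePlacement b x)
    (hbq : ∀ i, b i ≤ q) :
    Function.Injective fun s : Σ i, Fin (b i) => x s.1 + ((s.2 : ℕ) : ZMod q) := by
  have hne : ∀ i j (s : Fin (b i)) (t : Fin (b j)), i < j →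
      x i + ((s : ℕ) : ZMod q) ≠ x j + ((t : ℕ) : ZMod q) := by
    intro i j s t hij h
    have hs := s.2
    have ht := t.2
    refine hx i j hij ((t : ℕ) - (s : ℕ)) (by lia) (by lia) ?_
    push_cast
    rwa [sub_eq_sub_iff_add_eq_add, add_comm _ (x j)]
  rintro ⟨i, s⟩ ⟨j, t⟩ h
  rcases lt_trichotomy i j with hij | rfl | hij
  · exact absurd h (hne _ _ _ _ hij)
  · have hst := congrArg ZMod.val (add_left_cancel h)
    rw [ZMod.val_natCast_of_lt (s.2.trans_le (hbq i)),
      ZMod.val_natCast_of_lt (t.2.trans_le (hbq i))] at hst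
    rw [Fin.ext hst]
  · exact absurd h.symm (hne _ _ _ _ hij)

variable [Fintype ι]

theorem ncard_isCirclePlacement_and_isEmptyCell_neg_one [NeZero q] (hb : ∀ i, 0 < b i) :
    {x : ι → ZMod q | IsCirclePlacement b x ∧ IsEmptyCell b x (-1)}.ncard =
      (q - ∑ i, b i) ^ Fintype.card ι := by
  rw [← ncard_isLinePlacement hb]
  refine Set.BijOn.ncard_eq (f := fun x i => (x i).val) ?_
  refine Set.InvOn.bijOn (f' := fun p i => (p i : ZMod q)) ⟨?_, ?_⟩ ?_ ?_
  · exact fun x _ => funext fun i => ZMod.natCast_zmod_val (x i)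
  · exact fun p hp => funext fun i => ZMod.val_natCast_of_lt (by have := hp.1 i; lia)
  · exact fun x hx => hx.1.isLinePlacement_val hx.2
  · exact fun p hp => ⟨hp.isCirclePlacement_natCast, hp.isEmptyCell_natCast⟩

theorem ncard_isCirclePlacement_and_isEmptyCell [NeZero q] (hb : ∀ i, 0 < b i) (e : ZMod q) :
    {x : ι → ZMod q | IsCirclePlacement b x ∧ IsEmptyCell b x e}.ncard =
      (q - ∑ i, b i) ^ Fintype.card ι := by
  rw [← ncard_isCirclePlacement_and_isEmptyCell_neg_one hb]
  refine ((Equiv.addRight fun _ : ι => -1 - e).bijOn fun x => ?_).ncard_eq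
  have hcell := isEmptyCell_add_const_iff (b := b) (x := x) (c := -1 - e) (e := e)
  rw [add_sub_cancel] at hcell
  exact and_congr isCirclePlacement_add_const_iff hcell

theorem IsCirclePlacement.ncard_isEmptyCell [NeZero q] {x : ι → ZMod q}
    (hx : IsCirclePlacement b x) (hbq : ∀ i, b i ≤ q) :
    {e | IsEmptyCell b x e}.ncard = q - ∑ i, b i := by
  have hcompl : {e | IsEmptyCell b x e} =
      (Set.range fun s : Σ i, Fin (b i) => x s.1 + ((s.2 : ℕ) : ZMod q))ᶜ := by
    ext e
    simp [IsEmptyCell, Fin.forall_iff]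
  rw [hcompl, Set.ncard_compl, Set.ncard_range_of_injective (hx.injective_sigma hbq)]
  simp

theorem ncard_isCirclePlacement [Nonempty ι] [NeZero q] (hb : ∀ i, 0 < b i)
    (hq : ∑ i, b i < q) : {x : ι → ZMod q | IsCirclePlacement b x}.ncard =
      q * (q - ∑ i, b i) ^ (Fintype.card ι - 1) := by
  classical
  have hbq (i : ι) : b i ≤ q := (Finset.single_le_sum_of_canonicallyOrdered
    (Finset.mem_univ i)).trans hq.le
  have hcells : ∀ x ∈ ({x | IsCirclePlacement b x} : Finset (ι → ZMod q)),
      (Finset.univ.bipartiteAbove (IsEmptyCell b) x).card = q - ∑ i, b i := by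
    intro x hx
    rw [← (Finset.mem_filter_univ x |>.1 hx).ncard_isEmptyCell hbq, ← Set.ncard_coe_finset]
    simp [Finset.bipartiteAbove]
  have hplacements : ∀ e ∈ (Finset.univ : Finset (ZMod q)),
      (({x | IsCirclePlacement b x} : Finset (ι → ZMod q)).bipartiteBelow
        (IsEmptyCell b) e).card = (q - ∑ i, b i) ^ Fintype.card ι := by
    intro e _
    rw [← ncard_isCirclePlacement_and_isEmptyCell hb e, ← Set.ncard_coe_finset]
    simp [Finset.bipartiteBelow, Set.ofPred_and]
  have hcount := Finset.card_mul_eq_card_mul _ hcells hplacements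
  rw [Finset.card_univ, ZMod.card, ← Set.ncard_coe_finset, Finset.coe_filter_univ,
    ← Nat.sub_add_cancel (Fintype.card_pos (α := ι)), pow_succ, ← mul_assoc] at hcount
  exact Nat.eq_of_mul_eq_mul_right (Nat.sub_pos_of_lt hq) hcount

end CirclePlacements

section ExtendedShi

open DiffEquation

variable {ι : Type*} [Fintype ι] [LinearOrder ι]

/-- The equations `x i - x j = m` with `i < j` and `-b i < m ≤ b j`. For `b i = β i + 1` these are
the hyperplanes of the `β`-extended Shi arrangement. -/
noncomputable def shiEquations (b : ι → ℕ) : List (DiffEquation ι) :=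
  (({e | e.1 < e.2} : Finset (ι × ι)).sigma fun e => Finset.Ioc (-b e.1 : ℤ) (b e.2)).toList.map
    fun s => ⟨s.1.1, s.1.2, s.2⟩

theorem mem_avoidSet_map_form_shiEquations {R : Type*} [Ring R] {b : ι → ℕ} {x : ι → R} :
    x ∈ avoidSet ((shiEquations b).map (form R)) ↔
      ∀ i j, i < j → ∀ m : ℤ, -b i < m → m ≤ b j → x i - x j ≠ m := by
  rw [avoidSet, Set.mem_ofPred_eq, List.forall_mem_map, shiEquations, List.forall_mem_map]
  simp only [form_apply, ne_eq, sub_eq_zero, Finset.mem_toList, Finset.mem_sigma,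
    Finset.mem_filter_univ, Finset.mem_Ioc, and_imp]
  exact ⟨fun h i j hij m => h ⟨(i, j), m⟩ hij, fun h s hs => h s.1.1 s.1.2 hs s.2⟩

theorem isCharPoly_shiEquations [Nonempty ι] {b : ι → ℕ} (hb : ∀ i, 0 < b i) :
    IsCharPoly (shiEquations b) (X * (X - C (∑ i, b i : ℤ)) ^ (Fintype.card ι - 1)) := by
  filter_upwards [eventually_gt_atTop (∑ i, b i)] with q hq
  have : NeZero q := ⟨(Nat.zero_le _).trans_lt hq |>.ne'⟩
  have hpoints : avoidSet ((shiEquations b).map (form (ZMod q))) = {x | IsCirclePlacement b x} :=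
    Set.ext fun x => mem_avoidSet_map_form_shiEquations
  rw [hpoints, ncard_isCirclePlacement hb hq, eval_mul, eval_pow, eval_sub, eval_X, eval_C]
  push_cast [hq.le]
  rfl

theorem ncard_topes_shiEquations [Nonempty ι] {b : ι → ℕ} (hb : ∀ i, 0 < b i) :
    (topes ((shiEquations b).map (form ℝ)) Set.univ).ncard =
      (∑ i, b i + 1) ^ (Fintype.card ι - 1) := by
  have h := (isCharPoly_shiEquations hb).ncard_topes
  obtain ⟨k, hk⟩ := Nat.exists_eq_add_one_of_ne_zero (Fintype.card_ne_zero (α := ι))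
  rw [hk, Nat.add_sub_cancel] at h ⊢
  have heval : (-1 : ℤ) ^ (k + 1) * (X * (X - C (∑ i, b i : ℤ)) ^ k).eval (-1) =
      ((∑ i, b i + 1 : ℕ) : ℤ) ^ k := by
    rw [eval_mul, eval_pow, eval_sub, eval_X, eval_C, pow_succ, mul_assoc, ← mul_assoc (-1),
      neg_mul_neg, one_mul, one_mul, ← mul_pow]
    push_cast
    ring
  exact_mod_cast h.trans heval

variable {n : ℕ}

theorem sub_average_mem_sumZeroSpace (x : Fin n → ℝ) :
    (fun i => x i - (∑ k, x k) / n) ∈ sumZeroSpace n := by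
  change ∑ i, (x i - (∑ k, x k) / n) = 0
  rcases n.eq_zero_or_pos with rfl | hn
  · simp
  · have hn' : (n : ℝ) ≠ 0 := by positivity
    simp [mul_div_cancel₀, hn']

theorem topes_map_form_sumZeroSpace (L : List (DiffEquation (Fin n))) :
    topes (L.map (form ℝ)) (sumZeroSpace n) = topes (L.map (form ℝ)) Set.univ := by
  refine topes_eq_of_forall_exists (Set.subset_univ _) fun x _ _ => ?_
  refine ⟨_, sub_average_mem_sumZeroSpace x, ?_⟩
  simp [signVector]

theorem compl_sUnion_extendedShiArrangement (β : Fin n → ℕ) :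
    (⋃₀ extendedShiArrangement β)ᶜ =
      avoidSet (((shiEquations fun i => β i + 1).map (form ℝ)).map
        (·.comp (sumZeroSpace n).subtype.toAffineMap)) := by
  ext x
  rw [← preimage_avoidSet, Set.mem_preimage, mem_avoidSet_map_form_shiEquations]
  constructor
  · intro hx i j hij m hmi hmj h
    exact hx ⟨_, ⟨i, j, hij, m, by lia, by lia, rfl⟩, h⟩
  · rintro hx ⟨_, ⟨i, j, hij, m, hmi, hmj, rfl⟩, h⟩
    exact hx i j hij m (by lia) (by lia) h

theorem encard_arrangementRegions_extendedShiArrangement (β : Fin n → ℕ) :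
    (arrangementRegions (extendedShiArrangement β)).encard =
      (topes ((shiEquations fun i => β i + 1).map (form ℝ)) Set.univ).encard := by
  rw [encard_arrangementRegions _ (compl_sUnion_extendedShiArrangement β), ← topes_range,
    ← topes_map_form_sumZeroSpace]
  · congr 2
    simp
  · intro f _
    exact AffineMap.continuous_linear_iff.1 f.linear.continuous_of_finiteDimensional

end ExtendedShi

/-- The number of regions of the `β`-extended Shi arrangement is
`(∑_j (β(j) + 1) + 1)^(n - 1)`. -/
theorem mainTheorem6 (n : ℕ) (hn : 1 ≤ n) (β : Fin n → ℕ) :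
    (arrangementRegions (extendedShiArrangement β)).Finite ∧
      (arrangementRegions (extendedShiArrangement β)).ncard =
        ((∑ j : Fin n, (β j + 1)) + 1) ^ (n - 1) := by
  have hregions := encard_arrangementRegions_extendedShiArrangement β
  have : Nonempty (Fin n) := ⟨⟨0, hn⟩⟩
  constructor
  · rw [← Set.encard_lt_top_iff, hregions]
    exact (finite_topes _ _).encard_lt_top
  · rw [Set.ncard, hregions, ← Set.ncard, ncard_topes_shiEquations fun i => (β i).succ_pos,
      Fintype.card_fin]
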